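/- Let $G$ be a finite simple triangle-free graph such that both $G$ and its complement $\overline{G}$ have diameter $3$. Then $G$ is edge-reconstructible; that is, every finite simple graph $H$ with the same edge-deck as $G$ is isomorphic to $G$. Here the edge-deck of a graph $G$ is the multiset $\{G-e : e\in E(G)\}$ of its edge-deleted subgraphs (all vertices are kept), considered up to isomorphism. -/

import Mathlib

universe u v

/-- The edge-card `G - e`: the edge `e` is deleted and all vertices are kept. -/
def edgeCard {V : Type u} (G : SimpleGraph V) (e : G.edgeSet) : SimpleGraph V :=
  G.deleteEdges {(e : Sym2 V)}

/-- `G` and `H` have the same edge-deck: the multisets of their edge-cards, taken up to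
isomorphism, coincide. That is, some bijection between the edges of `G` and those of `H` carries
each edge-card of `G` to an isomorphic edge-card of `H`. -/
def SameEdgeDeck {V : Type u} {W : Type v} (G : SimpleGraph V) (H : SimpleGraph W) : Prop :=
  ∃ σ : G.edgeSet ≃ H.edgeSet,
    ∀ e : G.edgeSet, Nonempty (edgeCard G e ≃g edgeCard H (σ e))

/-- `G` is edge-reconstructible: it is isomorphic to every finite graph with the same
edge-deck. -/
def EdgeReconstructible {V : Type u} (G : SimpleGraph V) : Prop :=
  ∀ (W : Type v) [Finite W] (H : SimpleGraph W), SameEdgeDeck G H → Nonempty (G ≃g H)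

/-! Two vertices `u`, `v` at distance 3 in `Gᶜ` are adjacent in `G` and jointly dominate it.
Triangle-freeness makes `N(v)` and `N(u)` independent, so `G` is bipartite with centres `u`, `v`
joined to the whole opposite part, and neither part is a singleton.

If some edge `a b` avoids both centres, restoring an edge to `G - ab` must again give such a graph,
since otherwise some card would contain a triangle (`of_replace_edge`). Now restore an edge `x y` to
`G - uv`. Deleting an edge lowers the number of covering vertices by at most two, and deleting a
central edge lowers it by exactly two. Comparing decks forces `x` and `y` to be covering, so `x y`
is central, and transpositions carry `G` to the new graph (`nonempty_iso_of_move_edge`).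

Otherwise `G` is a double star. Every card but `G - uv` has an isolated vertex, so after `x y` is
restored every other edge is pendant; the few possible positions all give `G`
(`nonempty_iso_of_pendant`). -/

/-! ### Edge-cards and restoring an edge. -/

lemma edgeCard_adj {V : Type u} (G : SimpleGraph V) (e : G.edgeSet) (a b : V) :
    (edgeCard G e).Adj a b ↔ G.Adj a b ∧ s(a, b) ≠ (e : Sym2 V) := by
  simp [edgeCard]

/-- An isomorphism restricts to an isomorphism of corresponding edge-cards. -/
def edgeCardIso {V : Type u} {W : Type v} {G : SimpleGraph V} {H : SimpleGraph W} (i : G ≃g H)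
    (e : G.edgeSet) : edgeCard G e ≃g edgeCard H (i.mapEdgeSet e) where
  toEquiv := i.toEquiv
  map_rel_iff' := by
    intro a b
    obtain ⟨e, he⟩ := e
    have hinj : Function.Injective (Sym2.map i) := Sym2.map.injective i.injective
    have h1 : s(i a, i b) = Sym2.map i e ↔ s(a, b) = e := by
      rw [← Sym2.map_mk, hinj.eq_iff]
    rw [edgeCard_adj, edgeCard_adj]
    change (H.Adj (i a) (i b) ∧ s(i a, i b) ≠ Sym2.map i e) ↔ _
    rw [i.map_adj_iff, Ne, h1]

/-- A graph with the same edge-deck as `G` may be realised on the vertices of `G`, by adding one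
edge to any prescribed edge-card of `G`. -/
lemma SameEdgeDeck.exists_add_edge {V : Type u} {W : Type v} {G : SimpleGraph V}
    {H : SimpleGraph W} (h : SameEdgeDeck G H) (e : G.edgeSet) :
    ∃ (M : SimpleGraph V) (x y : V) (σ : G.edgeSet ≃ M.edgeSet),
      Nonempty (M ≃g H) ∧ (∀ d, Nonempty (edgeCard G d ≃g edgeCard M (σ d))) ∧
      (σ e : Sym2 V) = s(x, y) ∧ x ≠ y ∧ ¬ (edgeCard G e).Adj x y ∧
      ∀ a b, M.Adj a b ↔ (edgeCard G e).Adj a b ∨ s(a, b) = s(x, y) := by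
  obtain ⟨σ, hσ⟩ := h
  obtain ⟨φ⟩ := hσ e
  let i : H.comap φ.toEquiv ≃g H := SimpleGraph.Iso.comap φ.toEquiv H
  let τ := σ.trans i.symm.mapEdgeSet
  have hτ : ∀ d, Nonempty (edgeCard G d ≃g edgeCard (H.comap φ.toEquiv) (τ d)) := fun d =>
    ⟨(hσ d).some.trans (edgeCardIso i.symm (σ d))⟩
  obtain ⟨x, y, hxy⟩ : ∃ x y, (τ e : Sym2 V) = s(x, y) := by
    induction h : (τ e : Sym2 V) with
    | h x y => exact ⟨x, y, rfl⟩
  have hM : (H.comap φ.toEquiv).Adj x y := by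
    have := (τ e).2
    rwa [hxy] at this
  have hcard : ∀ a b, (edgeCard G e).Adj a b ↔
      (H.comap φ.toEquiv).Adj a b ∧ s(a, b) ≠ s(x, y) := by
    intro a b
    rw [← φ.map_adj_iff, edgeCard_adj, ← hxy]
    have h2 : (τ e : Sym2 V) = Sym2.map i.symm (σ e : Sym2 W) := rfl
    have h3 : s(a, b) = Sym2.map i.symm s(φ a, φ b) := by
      rw [Sym2.map_mk]
      change s(a, b) = s(φ.symm (φ a), φ.symm (φ b))
      simp
    rw [h2, h3, (Sym2.map.injective i.symm.injective).ne_iff]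
    rfl
  refine ⟨_, x, y, τ, ⟨i⟩, hτ, hxy, hM.ne, ?_, ?_⟩
  · rw [hcard]
    simp
  · intro a b
    rw [hcard]
    by_cases hab : s(a, b) = s(x, y)
    · simp only [hab, or_true, iff_true]
      rw [← SimpleGraph.mem_edgeSet, hab]
      exact hM
    · simp [hab]

/-! ### Spanning double stars and covering vertices. -/

/-- `G` is bipartite with parts `A` and `Aᶜ`, and `u ∈ A`, `v ∉ A` are joined to the whole
opposite part. -/
structure IsSpanningDoubleStar {V : Type u} (G : SimpleGraph V) (A : Set V) (u v : V) :
    Prop where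
  bip : ∀ a b, G.Adj a b → (a ∈ A ↔ b ∉ A)
  left_mem : u ∈ A
  right_notMem : v ∉ A
  left_adj : ∀ b, b ∉ A → G.Adj u b
  right_adj : ∀ a, a ∈ A → G.Adj v a

/-- The vertices whose neighbourhood is a vertex cover. -/
def coveringVertices {V : Type u} (G : SimpleGraph V) : Set V :=
  {x | ∀ a b, G.Adj a b → G.Adj x a ∨ G.Adj x b}

lemma ncard_coveringVertices_congr {V : Type u} {W : Type v} {G : SimpleGraph V}
    {H : SimpleGraph W} (i : G ≃g H) :
    (coveringVertices G).ncard = (coveringVertices H).ncard := by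
  have : coveringVertices H = i '' coveringVertices G := by
    ext w
    obtain ⟨x, rfl⟩ := i.surjective w
    rw [i.injective.mem_set_image]
    constructor
    · intro h a b hab
      have h1 := h (i a) (i b) (i.map_adj_iff.2 hab)
      rwa [i.map_adj_iff, i.map_adj_iff] at h1
    · intro h a b hab
      obtain ⟨a, rfl⟩ := i.surjective a
      obtain ⟨b, rfl⟩ := i.surjective b
      rw [i.map_adj_iff, i.map_adj_iff]
      exact h a b (i.map_adj_iff.1 hab)
  rw [this, Set.ncard_image_of_injective _ i.injective]

namespace IsSpanningDoubleStar

variable {V : Type u} {G : SimpleGraph V} {A : Set V} {u v : V}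

lemma adj (h : IsSpanningDoubleStar G A u v) : G.Adj u v := h.left_adj v h.right_notMem

lemma symm (h : IsSpanningDoubleStar G A u v) : IsSpanningDoubleStar G Aᶜ v u where
  bip a b hab := by have := h.bip a b hab; simp only [Set.mem_compl_iff]; tauto
  left_mem := h.right_notMem
  right_notMem := by simpa using h.left_mem
  left_adj b hb := h.right_adj b (by simpa using hb)
  right_adj a ha := h.left_adj a ha

lemma left_mem_coveringVertices (h : IsSpanningDoubleStar G A u v) :
    u ∈ coveringVertices G := by
  intro a b hab
  by_cases ha : a ∈ A
  · exact Or.inr (h.left_adj b ((h.bip a b hab).1 ha))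
  · exact Or.inl (h.left_adj a ha)

lemma adj_of_mem_coveringVertices (h : IsSpanningDoubleStar G A u v) {x b : V}
    (hx : x ∈ coveringVertices G) (hxA : x ∈ A) (hb : b ∉ A) : G.Adj x b := by
  rcases hx u b (h.left_adj b hb) with h1 | h1
  · exact absurd h.left_mem ((h.bip _ _ h1).1 hxA)
  · exact h1

/-- The joined pair may be replaced by any edge between covering vertices. -/
lemma of_mem_coveringVertices (h : IsSpanningDoubleStar G A u v) {x y : V} (hxy : G.Adj x y)
    (hx : x ∈ coveringVertices G) (hy : y ∈ coveringVertices G) (hxA : x ∈ A) :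
    IsSpanningDoubleStar G A x y where
  bip := h.bip
  left_mem := hxA
  right_notMem := (h.bip _ _ hxy).1 hxA
  left_adj _ hb := h.adj_of_mem_coveringVertices hx hxA hb
  right_adj a ha := h.symm.adj_of_mem_coveringVertices hy ((h.bip _ _ hxy).1 hxA)
    (by simpa using ha)

/-- Deleting the edge between the two centres removes exactly these from the covering vertices. -/
lemma coveringVertices_edgeCard (h : IsSpanningDoubleStar G A u v) {a b : V}
    (ha : a ∈ A) (hau : a ≠ u) (hb : b ∉ A) (hbv : b ≠ v) :
    coveringVertices (edgeCard G ⟨s(u, v), h.adj⟩) = coveringVertices G \ {u, v} := by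
  have huv := h.adj.ne
  have hu := h.left_mem
  have hv := h.right_notMem
  -- For `d ≠ t` the edge `s d` survives. A vertex `x` in the part of `s` cannot be adjacent to `s`,
  -- so it covers this edge through `d`.
  have key : ∀ (B : Set V) (s t : V) (hs : IsSpanningDoubleStar G B s t) (x : V),
      x ∈ B → s(s, t) = s(u, v) → (∀ c d, G.Adj c d ∧ s(c, d) ≠ s(u, v) →
        (G.Adj x c ∧ s(x, c) ≠ s(u, v)) ∨ (G.Adj x d ∧ s(x, d) ≠ s(u, v))) →
      ∀ d ∉ B, G.Adj x d := by
    intro B s t hs x hx hst H d hd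
    by_cases hdt : d = t
    · subst hdt
      exact (hs.right_adj x hx).symm
    · have h1 := hs.left_adj d hd
      have h2 : s(s, d) ≠ s(u, v) := by
        rw [← hst]
        intro h3
        rw [Sym2.congr_right] at h3
        exact hdt h3
      rcases H s d ⟨h1, h2⟩ with h4 | h4
      · exact absurd hs.left_mem ((hs.bip _ _ h4.1).1 hx)
      · exact h4.1
  ext x
  simp only [coveringVertices, Set.mem_ofPred_eq, edgeCard_adj, Set.mem_sdiff,
    Set.mem_insert_iff, Set.mem_singleton_iff, not_or]
  constructor
  · intro H
    refine ⟨?_, ?_, ?_⟩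
    · intro c d hcd
      have hbcd := h.bip c d hcd
      by_cases hx : x ∈ A
      · have := key A u v h x hx rfl H
        by_cases hc : c ∈ A
        · exact Or.inr (this d (hbcd.1 hc))
        · exact Or.inl (this c hc)
      · have := key Aᶜ v u h.symm x hx Sym2.eq_swap H
        by_cases hc : c ∈ A
        · exact Or.inl (this c (by simpa using hc))
        · exact Or.inr (this d (by simp; tauto))
    -- Having lost `v`, the vertex `u` no longer covers the edge `v a`.
    · rintro rfl
      have h1 := h.right_adj a ha
      have h2 := h.bip x a
      rcases H v a ⟨h1, by simp only [ne_eq, Sym2.eq_iff]; tauto⟩ with h3 | h3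
      · exact h3.2 rfl
      · exact h2 h3.1 |>.1 hu ha
    · rintro rfl
      have h1 := h.left_adj b hb
      have h2 := h.bip x b
      rcases H u b ⟨h1, by simp only [ne_eq, Sym2.eq_iff]; tauto⟩ with h3 | h3
      · exact h3.2 Sym2.eq_swap
      · exact hv ((h2 h3.1).2 hb)
  · rintro ⟨H, hxu, hxv⟩ c d ⟨hcd, -⟩
    rcases H c d hcd with h1 | h1
    · exact Or.inl ⟨h1, by simp only [ne_eq, Sym2.eq_iff]; tauto⟩
    · exact Or.inr ⟨h1, by simp only [ne_eq, Sym2.eq_iff]; tauto⟩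

end IsSpanningDoubleStar

/-! ### Counting covering vertices under edge deletion. -/

/-- Only the ends of the deleted edge lose a neighbour. -/
lemma coveringVertices_diff_subset {V : Type u} (G : SimpleGraph V) {x y : V}
    (hxy : G.Adj x y) :
    coveringVertices G \ {x, y} ⊆ coveringVertices (edgeCard G ⟨s(x, y), hxy⟩) := by
  rintro z ⟨hz, hne⟩ c d hcd
  simp only [Set.mem_insert_iff, Set.mem_singleton_iff, not_or] at hne
  simp only [edgeCard_adj] at hcd ⊢
  rcases hz c d hcd.1 with h1 | h1
  · exact Or.inl ⟨h1, by simp only [ne_eq, Sym2.eq_iff]; tauto⟩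
  · exact Or.inr ⟨h1, by simp only [ne_eq, Sym2.eq_iff]; tauto⟩

lemma ncard_coveringVertices_le {V : Type u} [Finite V] (G : SimpleGraph V) (e : G.edgeSet) :
    (coveringVertices G).ncard ≤ (coveringVertices (edgeCard G e)).ncard + 2 := by
  obtain ⟨e, he⟩ := e
  induction e with
  | h x y =>
    have hxy : G.Adj x y := he
    have h1 := Set.ncard_le_ncard (coveringVertices_diff_subset G hxy) (Set.toFinite _)
    have h2 := Set.ncard_le_ncard_sdiff_add_ncard (coveringVertices G) {x, y} (Set.toFinite _)
    have h3 := Set.ncard_pair hxy.ne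
    omega

/-- Only `x` and `y` can cease to be covering, so a drop of two accounts for both. -/
lemma mem_coveringVertices_of_ncard {V : Type u} [Finite V] (G : SimpleGraph V) {x y : V}
    (hxy : G.Adj x y)
    (h : (coveringVertices (edgeCard G ⟨s(x, y), hxy⟩)).ncard + 2 ≤
      (coveringVertices G).ncard) :
    x ∈ coveringVertices G ∧ y ∈ coveringVertices G := by
  have h1 := Set.ncard_le_ncard (coveringVertices_diff_subset G hxy) (Set.toFinite _)
  have h2 := Set.ncard_inter_add_ncard_sdiff_eq_ncard (coveringVertices G) {x, y} (Set.toFinite _)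
  have h3 : (coveringVertices G ∩ {x, y}).ncard = 2 := by
    have := Set.ncard_le_ncard (Set.inter_subset_right (s := coveringVertices G) (t := {x, y}))
      (Set.toFinite _)
    have := Set.ncard_pair hxy.ne
    omega
  have h4 : coveringVertices G ∩ {x, y} = {x, y} := by
    apply Set.eq_of_subset_of_ncard_le Set.inter_subset_right _ (Set.toFinite _)
    rw [h3]
    exact (Set.ncard_pair hxy.ne).le
  have h5 : ({x, y} : Set V) ⊆ coveringVertices G := Set.inter_eq_right.1 h4
  exact ⟨h5 (by simp), h5 (by simp)⟩

namespace IsSpanningDoubleStar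

lemma ncard_coveringVertices_edgeCard {V : Type u} [Finite V] {G : SimpleGraph V} {A : Set V}
    {u v : V} (h : IsSpanningDoubleStar G A u v) {a b : V}
    (ha : a ∈ A) (hau : a ≠ u) (hb : b ∉ A) (hbv : b ≠ v) :
    (coveringVertices (edgeCard G ⟨s(u, v), h.adj⟩)).ncard + 2 =
      (coveringVertices G).ncard := by
  rw [h.coveringVertices_edgeCard ha hau hb hbv, ← Set.ncard_pair h.adj.ne]
  apply Set.ncard_sdiff_add_ncard_of_subset _ (Set.toFinite _)
  rintro z (rfl | rfl)
  · exact h.left_mem_coveringVertices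
  · exact h.symm.left_mem_coveringVertices

/-! ### Moving the central edge. -/

/-- Two missing pairs of a bipartite graph, each vertex of which is joined to all other vertices
of the opposite part, are exchanged by an automorphism. -/
lemma nonempty_iso_of_add_edge {V : Type u} {G M : SimpleGraph V} {A : Set V} {u v x y : V}
    (h : IsSpanningDoubleStar G A u v) (hM : IsSpanningDoubleStar M A x y)
    (hGM : ∀ c d, (G.Adj c d ∧ s(c, d) ≠ s(u, v)) ↔ (M.Adj c d ∧ s(c, d) ≠ s(x, y))) :
    Nonempty (G ≃g M) := by
  classical
  have hu := h.left_mem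
  have hv := h.right_notMem
  have hx := hM.left_mem
  have hy := hM.right_notMem
  have hGM' : ∀ c d, c ∈ A → d ∉ A →
      ((G.Adj c d ∧ ¬(c = u ∧ d = v)) ↔ (M.Adj c d ∧ ¬(c = x ∧ d = y))) := by
    intro c d hc hd
    have h1 : ∀ p ∉ A, c ≠ p := fun p hp h => hp (h ▸ hc)
    have := hGM c d
    simp only [ne_eq, Sym2.eq_iff] at this
    simpa [h1 v hv, h1 y hy] using this
  have key : ∀ c d, c ∈ A → d ∉ A → (G.Adj c d ↔
      M.Adj (Equiv.swap v y (Equiv.swap u x c)) (Equiv.swap v y (Equiv.swap u x d))) := by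
    intro c d hc hd
    have h1 := h.left_adj
    have h2 := fun a ha => (h.right_adj a ha).symm
    have h3 := hM.left_adj
    have h4 := fun a ha => (hM.right_adj a ha).symm
    have hcd := hGM' c d hc hd
    have huv := hGM' u v hu hv
    have hxy := hGM' x y hx hy
    have huy := hGM' u y hu hy
    have hxv := hGM' x v hx hv
    have huy := hGM' u d hu hd
    have hxv := hGM' x d hx hd
    have huy := hGM' c y hc hy
    have hxv := hGM' c v hc hv
    have e1 : Equiv.swap u x d = d := Equiv.swap_apply_of_ne_of_ne
      (by rintro rfl; exact hd hu) (by rintro rfl; exact hd hx)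
    have e2 : Equiv.swap u x c ∈ A := by
      rw [Equiv.swap_apply_def]
      split_ifs <;> assumption
    have e3 : Equiv.swap v y (Equiv.swap u x c) = Equiv.swap u x c :=
      Equiv.swap_apply_of_ne_of_ne (fun h => hv (h ▸ e2)) (fun h => hy (h ▸ e2))
    rw [e1, e3, Equiv.swap_apply_def, Equiv.swap_apply_def]
    clear hGM hGM' e1 e2 e3 h hM
    grind
  have hpres : ∀ c, Equiv.swap v y (Equiv.swap u x c) ∈ A ↔ c ∈ A := by
    intro c
    rw [Equiv.swap_apply_def, Equiv.swap_apply_def]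
    grind
  refine ⟨⟨(Equiv.swap u x).trans (Equiv.swap v y), ?_⟩⟩
  intro c d
  change M.Adj (Equiv.swap v y (Equiv.swap u x c)) (Equiv.swap v y (Equiv.swap u x d)) ↔ _
  by_cases hc : c ∈ A
  · by_cases hd : d ∈ A
    · have h1 := h.bip c d
      have h2 := hM.bip (Equiv.swap v y (Equiv.swap u x c)) (Equiv.swap v y (Equiv.swap u x d))
      rw [hpres, hpres] at h2
      tauto
    · exact (key c d hc hd).symm
  · by_cases hd : d ∈ A
    · rw [G.adj_comm, M.adj_comm]
      exact (key d c hd hc).symm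
    · have h1 := h.bip c d
      have h2 := hM.bip (Equiv.swap v y (Equiv.swap u x c)) (Equiv.swap v y (Equiv.swap u x d))
      rw [hpres, hpres] at h2
      tauto

variable {V : Type u} {G M : SimpleGraph V} {A : Set V} {u v x y : V}

lemma comap {W : Type v} {H : SimpleGraph W} {B : Set W} {s t : W}
    (h : IsSpanningDoubleStar H B s t) (i : G ≃g H) :
    IsSpanningDoubleStar G (i ⁻¹' B) (i.symm s) (i.symm t) where
  bip a b hab := h.bip _ _ (i.map_adj_iff.2 hab)
  left_mem := by simpa using h.left_mem
  right_notMem := by simpa using h.right_notMem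
  left_adj b hb := by
    rw [← i.map_adj_iff]
    simpa using h.left_adj (i b) hb
  right_adj b hb := by
    rw [← i.map_adj_iff]
    simpa using h.right_adj (i b) hb

lemma no_triangle (h : IsSpanningDoubleStar G A u v) {a b c : V} (hab : G.Adj a b)
    (hbc : G.Adj b c) (hac : G.Adj a c) : False := by
  have h1 := h.bip a b hab
  have h2 := h.bip b c hbc
  have h3 := h.bip a c hac
  tauto

/-- Every vertex is adjacent to one of the two centres. -/
lemma adj_or_adj (h : IsSpanningDoubleStar G A u v) (c : V) : G.Adj u c ∨ G.Adj v c := by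
  by_cases hc : c ∈ A
  · exact Or.inr (h.right_adj c hc)
  · exact Or.inl (h.left_adj c hc)

/-- Moving the edge between the centres to another place where it again joins two centres yields
an isomorphic graph, provided that `G` is not a double star. -/
lemma nonempty_iso_of_move_edge (h : IsSpanningDoubleStar G A u v) {B : Set V}
    (hM : IsSpanningDoubleStar M B x y)
    (hGM : ∀ c d, M.Adj c d ↔ (G.Adj c d ∧ s(c, d) ≠ s(u, v)) ∨ s(c, d) = s(x, y))
    (hxy : ¬(G.Adj x y ∧ s(x, y) ≠ s(u, v))) {a b : V} (ha : a ∈ A) (hau : a ≠ u)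
    (hb : b ∉ A) (hbv : b ≠ v) (hab : G.Adj a b) : Nonempty (G ≃g M) := by
  have hdiff : ∀ c d, (G.Adj c d ∧ s(c, d) ≠ s(u, v)) ↔ (M.Adj c d ∧ s(c, d) ≠ s(x, y)) := by
    intro c d
    rw [hGM]
    by_cases hcd : s(c, d) = s(x, y)
    · have : ¬(G.Adj c d ∧ s(c, d) ≠ s(u, v)) := by
        rw [hcd, ← SimpleGraph.mem_edgeSet, hcd]
        exact hxy
      tauto
    · tauto
  -- When the new edge crosses `A`, the graph `M` is bipartite for `A` too, and domination by `s`,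
  -- `t` makes them centres for `A`; `B` need not be compared with `A`.
  have hcross : ∀ s t, IsSpanningDoubleStar M B s t ∨ IsSpanningDoubleStar M Bᶜ s t →
      s(s, t) = s(x, y) → s ∈ A → t ∉ A → Nonempty (G ≃g M) := by
    intro s t hst hxy' hs ht
    have hbip : ∀ c d, M.Adj c d → (c ∈ A ↔ d ∉ A) := by
      intro c d hcd
      rcases (hGM c d).1 hcd with h1 | h1
      · exact h.bip c d h1.1
      · rw [← hxy', Sym2.eq_iff] at h1
        rcases h1 with ⟨rfl, rfl⟩ | ⟨rfl, rfl⟩ <;> tauto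
    have hor : ∀ c, M.Adj s c ∨ M.Adj t c := by
      rcases hst with hst | hst <;> exact hst.adj_or_adj
    refine h.nonempty_iso_of_add_edge (M := M) (x := s) (y := t) ⟨hbip, hs, ht, ?_, ?_⟩
      (by rwa [hxy'])
    · intro c hc
      rcases hor c with h1 | h1
      · exact h1
      · have := hbip _ _ h1
        tauto
    · intro c hc
      rcases hor c with h1 | h1
      · have := hbip _ _ h1
        tauto
      · exact h1
  -- With `x`, `y` both in `C`, domination forces `C = {x, y} = {s, c}`; then `s`, `c`, `d` form a
  -- triangle.
  have hside : ∀ (C : Set V) (s t c d : V), IsSpanningDoubleStar G C s t → s(s, t) = s(u, v) →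
      c ∈ C → c ≠ s → d ∉ C → d ≠ t → G.Adj c d → x ∈ C → y ∈ C → False := by
    intro C s t c d hC hst hc hcs hd hdt hcd hx hy
    have hmem : ∀ z ∈ C, z = x ∨ z = y := by
      intro z hz
      have := hM.adj_or_adj z
      rw [hGM, hGM] at this
      simp only [Sym2.eq_iff] at this
      have h1 := hC.bip x z
      have h2 := hC.bip y z
      tauto
    have hxyM := hM.adj
    have hdx : ∀ z ∈ C, M.Adj s d ∧ M.Adj c d := by
      intro z hz
      have hs := hC.left_mem
      rw [hGM, hGM, ← hst]
      simp only [ne_eq, Sym2.eq_iff]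
      refine ⟨Or.inl ⟨hC.left_adj d hd, ?_⟩, Or.inl ⟨hcd, ?_⟩⟩
      · rintro (⟨-, h1⟩ | ⟨-, h1⟩)
        · exact hdt h1
        · exact hd (h1 ▸ hs)
      · rintro (⟨h1, -⟩ | ⟨-, h1⟩)
        · exact hcs h1
        · exact hd (h1 ▸ hs)
    obtain ⟨h1, h2⟩ := hdx c hc
    have h3 : M.Adj s c := by
      rcases hmem s hC.left_mem with rfl | rfl <;> rcases hmem c hc with rfl | rfl
      · exact absurd rfl hcs
      · exact hxyM
      · exact hxyM.symm
      · exact absurd rfl hcs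
    exact hM.no_triangle h3 h2 h1
  by_cases hx : x ∈ A <;> by_cases hy : y ∈ A
  · exact (hside A u v a b h rfl ha hau hb hbv hab hx hy).elim
  · exact hcross x y (Or.inl hM) rfl hx hy
  · exact hcross y x (Or.inr hM.symm) Sym2.eq_swap hy hx
  · exact (hside Aᶜ v u b a h.symm Sym2.eq_swap hb hbv (by simpa using ha) hau hab.symm
      hx hy).elim

/-! ### Replacing an edge that avoids the centres. -/

/-- If an edge `a b` avoiding the centres is replaced by `x y`, and no edge-card of the new graph
contains a triangle, then `x` and `y` do not both lie in `A`. -/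
lemma not_mem_and_mem (h : IsSpanningDoubleStar G A u v) {a b : V} (hau : a ≠ u) (hav : a ≠ v)
    (hbu : b ≠ u) (hbv : b ≠ v) (hb : b ∉ A)
    (hGM : ∀ c d, M.Adj c d ↔ (G.Adj c d ∧ s(c, d) ≠ s(a, b)) ∨ s(c, d) = s(x, y))
    (hcard : ∀ f : M.edgeSet, ∃ e : G.edgeSet, Nonempty (edgeCard G e ≃g edgeCard M f)) :
    ¬(x ∈ A ∧ y ∈ A) := by
  rintro ⟨hx, hy⟩
  have hu := h.left_mem
  have hv := h.right_notMem
  have hub : M.Adj u b := by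
    rw [hGM]
    refine Or.inl ⟨h.left_adj b hb, ?_⟩
    simp only [ne_eq, Sym2.eq_iff]
    tauto
  have hvA : ∀ z ∈ A, M.Adj v z := by
    intro z hz
    rw [hGM]
    refine Or.inl ⟨h.right_adj z hz, ?_⟩
    simp only [ne_eq, Sym2.eq_iff]
    tauto
  have hxyM : M.Adj x y := by rw [hGM]; exact Or.inr rfl
  -- The triangle `v x y` avoids the edge `u b`, so it survives in this card, which is also a card
  -- of `G`.
  obtain ⟨e, ⟨i⟩⟩ := hcard ⟨s(u, b), hub⟩
  have hpull : ∀ c d, M.Adj c d → c ≠ b → d ≠ b → G.Adj (i.symm c) (i.symm d) := by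
    intro c d hcd hc hd
    have : (edgeCard G e).Adj (i.symm c) (i.symm d) := by
      rw [i.symm.map_adj_iff, edgeCard_adj]
      refine ⟨hcd, ?_⟩
      simp only [ne_eq, Sym2.eq_iff]
      tauto
    exact ((edgeCard_adj _ _ _ _).1 this).1
  have hxb : x ≠ b := fun h => hb (h ▸ hx)
  have hyb : y ≠ b := fun h => hb (h ▸ hy)
  exact h.no_triangle (hpull v x (hvA x hx) hbv.symm hxb) (hpull x y hxyM hxb hyb)
    (hpull v y (hvA y hy) hbv.symm hyb)

/-- Replacing an edge that avoids the centres keeps the spanning double star, if no edge-card of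
the new graph contains a triangle. -/
lemma of_replace_edge (h : IsSpanningDoubleStar G A u v) {a b : V} (ha : a ∈ A) (hau : a ≠ u)
    (hb : b ∉ A) (hbv : b ≠ v)
    (hGM : ∀ c d, M.Adj c d ↔ (G.Adj c d ∧ s(c, d) ≠ s(a, b)) ∨ s(c, d) = s(x, y))
    (hcard : ∀ f : M.edgeSet, ∃ e : G.edgeSet, Nonempty (edgeCard G e ≃g edgeCard M f)) :
    IsSpanningDoubleStar M A u v := by
  have hu := h.left_mem
  have hv := h.right_notMem
  have hav : a ≠ v := fun h => hv (h ▸ ha)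
  have hbu : b ≠ u := fun h => hb (h ▸ hu)
  have h1 := h.not_mem_and_mem hau hav hbu hbv hb hGM hcard
  have h2 := h.symm.not_mem_and_mem (a := b) (b := a) hbv hbu hav hau (by simpa using ha)
    (by simpa only [Sym2.eq_swap (a := b)] using hGM) hcard
  simp only [Set.mem_compl_iff] at h2
  refine ⟨?_, hu, hv, ?_, ?_⟩
  · intro c d hcd
    rcases (hGM c d).1 hcd with h3 | h3
    · exact h.bip c d h3.1
    · rw [Sym2.eq_iff] at h3
      rcases h3 with ⟨rfl, rfl⟩ | ⟨rfl, rfl⟩ <;> tauto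
  · intro z hz
    rw [hGM]
    refine Or.inl ⟨h.left_adj z hz, ?_⟩
    simp only [ne_eq, Sym2.eq_iff]
    tauto
  · intro z hz
    rw [hGM]
    refine Or.inl ⟨h.right_adj z hz, ?_⟩
    simp only [ne_eq, Sym2.eq_iff]
    tauto

lemma nonempty_iso_of_sameEdgeDeck [Finite V] (h : IsSpanningDoubleStar G A u v)
    {W : Type v} {H : SimpleGraph W} (hd : SameEdgeDeck G H) {a b : V} (ha : a ∈ A)
    (hau : a ≠ u) (hb : b ∉ A) (hbv : b ≠ v) (hab : G.Adj a b) : Nonempty (G ≃g H) := by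
  obtain ⟨B, s, t, hH, ⟨c, hc, hcs⟩, d, hd', hdt⟩ : ∃ B s t, IsSpanningDoubleStar H B s t ∧
      (∃ c ∈ B, c ≠ s) ∧ ∃ d ∉ B, d ≠ t := by
    obtain ⟨M, x, y, σ, ⟨i⟩, hσ, -, -, -, hGM⟩ := hd.exists_add_edge ⟨s(a, b), hab⟩
    simp only [edgeCard_adj] at hGM
    exact ⟨_, _, _, (h.of_replace_edge ha hau hb hbv hGM
      (fun f => ⟨σ.symm f, by simpa using hσ (σ.symm f)⟩)).comap i.symm,
      ⟨i a, by simpa using ha, fun h => hau (i.injective h)⟩,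
      i b, by simpa using hb, fun h => hbv (i.injective h)⟩
  obtain ⟨M, x, y, σ, ⟨i⟩, hσ, hσe, -, hnot, hGM⟩ := hd.exists_add_edge ⟨s(u, v), h.adj⟩
  have hM := hH.comap i
  have hcG := h.ncard_coveringVertices_edgeCard ha hau hb hbv
  have hcM := ncard_coveringVertices_congr (hσ ⟨s(u, v), h.adj⟩).some
  -- A central edge of `M` costs exactly two covering vertices; the matching edge of `G` costs at
  -- most two.
  have hle : (coveringVertices G).ncard ≤ (coveringVertices M).ncard := by
    have h1 := ncard_coveringVertices_le G (σ.symm ⟨s(i.symm s, i.symm t), hM.adj⟩)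
    have h2 := ncard_coveringVertices_congr (hσ (σ.symm ⟨s(i.symm s, i.symm t), hM.adj⟩)).some
    rw [Equiv.apply_symm_apply] at h2
    have h3 := hM.ncard_coveringVertices_edgeCard (a := i.symm c) (b := i.symm d)
      (by simpa using hc) (fun h => hcs (i.symm.injective h))
      (by simpa using hd') (fun h => hdt (i.symm.injective h))
    omega
  have hadj : M.Adj x y := by rw [hGM]; exact Or.inr rfl
  have hσe' : σ ⟨s(u, v), h.adj⟩ = ⟨s(x, y), hadj⟩ := Subtype.ext hσe
  rw [hσe'] at hcM
  obtain ⟨hx, hy⟩ := mem_coveringVertices_of_ncard M hadj (by omega)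
  simp only [edgeCard_adj] at hnot hGM
  obtain ⟨j⟩ : Nonempty (G ≃g M) := by
    by_cases hxB : x ∈ i ⁻¹' B
    · exact h.nonempty_iso_of_move_edge (hM.of_mem_coveringVertices hadj hx hy hxB) hGM hnot
        ha hau hb hbv hab
    · exact h.nonempty_iso_of_move_edge (hM.symm.of_mem_coveringVertices hadj hx hy hxB) hGM
        hnot ha hau hb hbv hab
  exact ⟨j.trans i⟩

/-! ### Double stars. -/

/-- In a double star, deleting an edge other than the central one isolates a vertex. -/
lemma exists_isolated (h : IsSpanningDoubleStar G A u v)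
    (hstar : ∀ c ∈ A, c ≠ u → ∀ d ∉ A, d ≠ v → ¬G.Adj c d) (e : G.edgeSet)
    (he : (e : Sym2 V) ≠ s(u, v)) : ∃ w, ∀ z, ¬(edgeCard G e).Adj w z := by
  have key : ∀ c d, G.Adj c d → c ∈ A → s(c, d) ≠ s(u, v) →
      ∃ w, ∀ z, G.Adj w z → s(w, z) = s(c, d) := by
    intro c d hcd hc hne
    have hd := (h.bip c d hcd).1 hc
    by_cases hcu : c = u
    · subst hcu
      have hdv : d ≠ v := fun h => hne (by rw [h])
      refine ⟨d, fun z hz => ?_⟩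
      have hzA : z ∈ A := by have := h.bip d z hz; tauto
      have : z = c := by
        by_contra hzc
        exact hstar z hzA hzc d hd hdv hz.symm
      rw [this, Sym2.eq_swap]
    · refine ⟨c, fun z hz => ?_⟩
      have hdv : d = v := by
        by_contra hdv
        exact hstar c hc hcu d hd hdv hcd
      have hzv : z = v := by
        by_contra hzv
        exact hstar c hc hcu z ((h.bip c z hz).1 hc) hzv hz
      rw [hdv, hzv]
  obtain ⟨e, hmem⟩ := e
  obtain ⟨w, hw⟩ : ∃ w, ∀ z, G.Adj w z → s(w, z) = e := by
    induction e with
    | h c d =>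
      have hcd : G.Adj c d := hmem
      by_cases hc : c ∈ A
      · exact key c d hcd hc he
      · have hd : d ∈ A := by have := h.bip c d hcd; tauto
        have := key d c hcd.symm hd (by rwa [Sym2.eq_swap])
        rwa [Sym2.eq_swap] at this
  refine ⟨w, fun z hz => ?_⟩
  rw [edgeCard_adj] at hz
  exact hz.2 (hw z hz.1)

set_option maxHeartbeats 1000000 in
/-- If the central edge of a double star is moved and every other edge still has an end of degree
one, then the result is isomorphic to the double star. -/
lemma nonempty_iso_of_pendant (h : IsSpanningDoubleStar G A u v)
    (hstar : ∀ c ∈ A, c ≠ u → ∀ d ∉ A, d ≠ v → ¬G.Adj c d) {a b : V} (ha : a ∈ A)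
    (hau : a ≠ u) (hb : b ∉ A) (hbv : b ≠ v) (hxy : x ≠ y)
    (hnot : ¬(G.Adj x y ∧ s(x, y) ≠ s(u, v)))
    (hGM : ∀ c d, M.Adj c d ↔ (G.Adj c d ∧ s(c, d) ≠ s(u, v)) ∨ s(c, d) = s(x, y))
    (hpend : ∀ c d, M.Adj c d → s(c, d) ≠ s(x, y) →
      ∃ w, ∀ z, M.Adj w z → s(w, z) = s(c, d)) : Nonempty (G ≃g M) := by
  classical
  have hu := h.left_mem
  have hv := h.right_notMem
  have hG : ∀ c d, G.Adj c d ↔ (c = u ∧ d ∉ A) ∨ (d = u ∧ c ∉ A) ∨ (c = v ∧ d ∈ A) ∨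
      (d = v ∧ c ∈ A) := by
    intro c d
    constructor
    · intro hcd
      have h1 := h.bip c d hcd
      by_cases hc : c ∈ A
      · have := hstar c hc
        have := fun h1 h2 h3 => this h1 d h2 h3 hcd
        tauto
      · have := fun h1 h2 h3 h4 => hstar d h1 h2 c h3 h4 hcd.symm
        tauto
    · rintro (⟨rfl, h1⟩ | ⟨rfl, h1⟩ | ⟨rfl, h1⟩ | ⟨rfl, h1⟩)
      · exact h.left_adj _ h1
      · exact (h.left_adj _ h1).symm
      · exact h.right_adj _ h1
      · exact (h.right_adj _ h1).symm
  have hav : a ≠ v := fun h => hv (h ▸ ha)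
  have hbu : b ≠ u := fun h => hb (h ▸ hu)
  have hvu : v ≠ u := fun h => hv (h ▸ hu)
  -- `hpend` would hold vacuously at an isolated `w`. No vertex of `M` is isolated, so `w` is an end
  -- of `c d`.
  have hpair : ∀ c d, G.Adj c d → s(c, d) ≠ s(u, v) →
      (∀ z, M.Adj c z → z = d) ∨ (∀ z, M.Adj d z → z = c) := by
    intro c d hcd hne
    obtain ⟨w, hw⟩ := hpend c d ((hGM c d).2 (Or.inl ⟨hcd, hne⟩)) (by
      intro h1
      rw [← h1, ← SimpleGraph.mem_edgeSet, ← h1] at hnot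
      exact hnot ⟨hcd, hne⟩)
    obtain ⟨z, hz⟩ : ∃ z, M.Adj w z := by
      by_cases hwA : w ∈ A
      · by_cases hwu : w = u
        · exact ⟨b, (hGM w b).2 (Or.inl ⟨hwu ▸ h.left_adj b hb, by
            simp only [ne_eq, Sym2.eq_iff]
            tauto⟩)⟩
        · exact ⟨v, (hGM w v).2 (Or.inl ⟨(h.right_adj w hwA).symm, by
            simp only [ne_eq, Sym2.eq_iff]
            tauto⟩)⟩
      · by_cases hwv : w = v
        · exact ⟨a, (hGM w a).2 (Or.inl ⟨hwv ▸ h.right_adj a ha, by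
            simp only [ne_eq, Sym2.eq_iff]
            tauto⟩)⟩
        · exact ⟨u, (hGM w u).2 (Or.inl ⟨(h.left_adj w hwA).symm, by
            simp only [ne_eq, Sym2.eq_iff]
            tauto⟩)⟩
    have hwcd := hw z hz
    rw [Sym2.eq_iff] at hwcd
    rcases hwcd with ⟨rfl, -⟩ | ⟨rfl, -⟩
    · exact Or.inl fun z hz => Sym2.congr_right.1 (hw z hz)
    · exact Or.inr fun z hz => Sym2.congr_right.1 ((hw z hz).trans Sym2.eq_swap)
  have hPA : ∀ c ∈ A, c ≠ u → (∀ z, M.Adj v z → z = c) ∨ (∀ z, M.Adj c z → z = v) :=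
    fun c hc hcu => hpair v c (h.right_adj c hc) (by
      simp only [ne_eq, Sym2.eq_iff]
      tauto)
  have hPB : ∀ c ∉ A, c ≠ v → (∀ z, M.Adj u z → z = c) ∨ (∀ z, M.Adj c z → z = u) :=
    fun c hc hcv => hpair u c (h.left_adj c hc) (by
      simp only [ne_eq, Sym2.eq_iff]
      tauto)
  have hM : ∀ c d, M.Adj c d ↔ ((c = u ∧ d ∉ A ∧ d ≠ v) ∨ (d = u ∧ c ∉ A ∧ c ≠ v) ∨
      (c = v ∧ d ∈ A ∧ d ≠ u) ∨ (d = v ∧ c ∈ A ∧ c ≠ u)) ∨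
      (c = x ∧ d = y) ∨ (c = y ∧ d = x) := by
    intro c d
    rw [hGM, hG]
    simp only [ne_eq, Sym2.eq_iff]
    clear hpair hpend hGM hstar h hnot hPA hPB hG
    grind
  simp only [hG, ne_eq, Sym2.eq_iff] at hnot
  clear hpair hpend hGM hstar h
  -- Here `s` is adjacent to both `u` and `v`, so the pendant end of `v s` is `v`. Hence `A = {u,
  -- s}`, and `s` and `v` exchange roles.
  have hUA : ∀ s ∈ A, s ≠ u → (x = u ∧ y = s ∨ x = s ∧ y = u) → Nonempty (G ≃g M) := by
    intro s hs hsu hst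
    have hsing : ∀ z ∈ A, z = u ∨ z = s := by
      have := hPA s hs hsu
      have := hM s u
      intro z hz
      have := hM v z
      grind
    clear hPA hPB hnot
    refine ⟨⟨Equiv.swap s v, ?_⟩⟩
    intro c d
    rw [hM, hG, Equiv.swap_apply_def, Equiv.swap_apply_def]
    grind
  have hVB : ∀ s ∉ A, s ≠ v → (x = v ∧ y = s ∨ x = s ∧ y = v) → Nonempty (G ≃g M) := by
    intro s hs hsu hst
    have hsing : ∀ z ∉ A, z = v ∨ z = s := by
      have := hPB s hs hsu
      have := hM s v
      intro z hz
      have := hM u z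
      grind
    clear hPA hPB hnot hUA
    refine ⟨⟨Equiv.swap s u, ?_⟩⟩
    intro c d
    rw [hM, hG, Equiv.swap_apply_def, Equiv.swap_apply_def]
    grind
  have hAB : ∀ s ∈ A, ∀ t ∉ A, (x = s ∧ y = t ∨ x = t ∧ y = s) → Nonempty (G ≃g M) := by
    intro s hs t ht hst
    by_cases hsu : s = u
    · have htv : t = v := by grind
      refine ⟨⟨Equiv.refl V, ?_⟩⟩
      intro c d
      simp only [Equiv.refl_apply]
      rw [hM, hG]
      clear hPA hPB hUA hVB
      grind
    -- Both parts have two vertices: `G` is the path `s v u t` and `M` the path `v s t u`.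
    · have htv : t ≠ v := by grind
      have hA : ∀ z ∈ A, z = u ∨ z = s := by
        have := hPA s hs hsu
        have := hM s t
        intro z hz
        have := hM v z
        grind
      have hB : ∀ z ∉ A, z = v ∨ z = t := by
        have := hPB t ht htv
        have := hM t s
        intro z hz
        have := hM u z
        grind
      clear hPA hPB hUA hVB hnot
      refine ⟨⟨(Equiv.swap s v).trans (Equiv.swap t u), ?_⟩⟩
      intro c d
      simp only [Equiv.trans_apply]
      have hval : ∀ c, (c = u ∧ Equiv.swap t u (Equiv.swap s v c) = t) ∨
          (c = v ∧ Equiv.swap t u (Equiv.swap s v c) = s) ∨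
          (c = s ∧ Equiv.swap t u (Equiv.swap s v c) = v) ∨
          (c = t ∧ Equiv.swap t u (Equiv.swap s v c) = u) := by
        intro c
        rw [Equiv.swap_apply_def, Equiv.swap_apply_def]
        have := hA c
        have := hB c
        grind
      rw [hM, hG]
      have := hval c
      have := hval d
      clear hM hG hval hA hB
      grind
  by_cases hx : x ∈ A <;> by_cases hy : y ∈ A
  · by_cases hxu : x = u
    · exact hUA y hy (by grind) (by tauto)
    by_cases hyu : y = u
    · exact hUA x hx hxu (by tauto)
    -- Now `v x y` is a triangle, so `v x` has no pendant end.
    have h1 := hPA x hx hxu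
    have h2 := hM v y
    have h3 := hM x y
    grind
  · exact hAB x hx y hy (by tauto)
  · exact hAB y hy x hx (by tauto)
  · by_cases hxv : x = v
    · exact hVB y hy (by grind) (by tauto)
    by_cases hyv : y = v
    · exact hVB x hx hxv (by tauto)
    have h1 := hPB x hx hxv
    have h2 := hM u y
    have h3 := hM x y
    grind

end IsSpanningDoubleStar

/-! ### The main theorem. -/

theorem theorem7 {V : Type u} [Finite V] (G : SimpleGraph V)
    (hfree : G.CliqueFree 3) (hdiam : G.diam = 3) (hcodiam : Gᶜ.diam = 3) :
    EdgeReconstructible.{u, v} G := by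
  intro W _ H hd
  obtain ⟨A, u, v, h, ⟨a, ha, hau⟩, b, hb, hbv⟩ : ∃ A u v, IsSpanningDoubleStar G A u v ∧
      (∃ a ∈ A, a ≠ u) ∧ ∃ b ∉ A, b ≠ v := by
    have htri : ∀ a b c, G.Adj a b → G.Adj b c → G.Adj a c → False := by
      classical
      intro a b c hab hbc hac
      exact hfree {a, b, c} (SimpleGraph.is3Clique_triple_iff.2 ⟨hab, hac, hbc⟩)
    have : Nonempty V := by
      by_contra hV
      rw [not_nonempty_iff] at hV
      have : Gᶜ.diam = 0 := by
        rw [SimpleGraph.diam_eq_zero]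
        exact Or.inr inferInstance
      omega
    obtain ⟨u, v, huv⟩ := Gᶜ.exists_dist_eq_diam
    rw [hcodiam] at huv
    have hne : u ≠ v := by
      rintro rfl
      simp at huv
    have hadj : G.Adj u v := by
      by_contra hn
      have : Gᶜ.Adj u v := ⟨hne, hn⟩
      rw [SimpleGraph.dist_eq_one_iff_adj.2 this] at huv
      omega
    have hdom : ∀ w, G.Adj u w ∨ G.Adj v w := by
      intro w
      by_cases hwu : w = u
      · exact Or.inr (hwu ▸ hadj.symm)
      by_cases hwv : w = v
      · exact Or.inl (hwv ▸ hadj)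
      by_contra! hn
      have h1 : Gᶜ.Adj u w := ⟨Ne.symm hwu, hn.1⟩
      have h2 : Gᶜ.Adj w v := ⟨hwv, fun h => hn.2 h.symm⟩
      have := SimpleGraph.dist_le (h1.toWalk.append h2.toWalk)
      simp at this
      omega
    have hreach : Gᶜ.Reachable u v := SimpleGraph.Reachable.of_dist_ne_zero (by omega)
    -- Neither `u` nor `v` is isolated in `Gᶜ`; a non-neighbour of each is a second vertex in its
    -- own part.
    have hnbr : ∀ s t, s ≠ t → Gᶜ.Reachable s t → ∃ w, w ≠ s ∧ ¬G.Adj s w := by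
      rintro s t hst ⟨p⟩
      cases p with
      | nil => exact absurd rfl hst
      | cons h p => exact ⟨_, h.1.symm, h.2⟩
    refine ⟨{w | G.Adj v w}, u, v, ⟨?_, hadj.symm, G.loopless.irrefl v, ?_, fun a ha => ha⟩, ?_, ?_⟩
    · intro a b hab
      simp only [Set.mem_ofPred_eq]
      refine ⟨fun h1 h2 => htri v a b h1 hab h2, fun h1 => ?_⟩
      by_contra h2
      exact htri u a b ((hdom a).resolve_right h2) hab ((hdom b).resolve_right h1)
    · intro b hb
      exact (hdom b).resolve_right hb
    · obtain ⟨w, hw, hw'⟩ := hnbr u v hne hreach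
      exact ⟨w, (hdom w).resolve_left hw', hw⟩
    · obtain ⟨w, hw, hw'⟩ := hnbr v u hne.symm hreach.symm
      exact ⟨w, hw', hw⟩
  by_cases hstar : ∀ c ∈ A, c ≠ u → ∀ d ∉ A, d ≠ v → ¬G.Adj c d
  · obtain ⟨M, x, y, σ, ⟨i⟩, hσ, hσe, hxy, hnot, hGM⟩ := hd.exists_add_edge ⟨s(u, v), h.adj⟩
    simp only [edgeCard_adj] at hnot hGM
    obtain ⟨j⟩ := h.nonempty_iso_of_pendant hstar ha hau hb hbv hxy hnot hGM (by
      intro c d hcd hne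
      -- An isolated vertex of the card `M - cd` has no edge in `M` other than `c d`.
      have hiso := h.exists_isolated hstar (σ.symm ⟨s(c, d), hcd⟩) (by
        intro he
        apply hne
        rw [← hσe]
        have : σ.symm ⟨s(c, d), hcd⟩ = ⟨s(u, v), h.adj⟩ := Subtype.ext he
        rw [← this, Equiv.apply_symm_apply])
      obtain ⟨k⟩ := hσ (σ.symm ⟨s(c, d), hcd⟩)
      obtain ⟨w, hw⟩ := hiso
      rw [Equiv.apply_symm_apply] at k
      refine ⟨k w, fun z hz => ?_⟩
      by_contra hz'
      apply hw (k.symm z)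
      rw [← k.map_adj_iff, edgeCard_adj]
      rw [RelIso.apply_symm_apply]
      exact ⟨hz, hz'⟩)
    exact ⟨j.trans i⟩
  · push Not at hstar
    obtain ⟨c, hc, hcu, d, hd', hdv, hcd⟩ := hstar
    exact h.nonempty_iso_of_sameEdgeDeck hd hc hcu hd' hdv hcd
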